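/- For a metric space $M$, a \emph{geodesic} from $x_0$ to $x_1$ is a path $\gamma:I=[0,1]\to M$ with $\gamma(0)=x_0$, $\gamma(1)=x_1$ and, for some constant $c$, $d(\gamma(t),\gamma(t'))=c\,|t-t'|$ for all $t,t'\in I$; $M$ is \emph{geodesic} if any two of its points are joined by a geodesic. The length of a path is the supremum of the sums of distances between successive points on it. All spaces of maps carry the compact-open topology. Let $X$ be a metric space with geodesic completion $\overline X$. A \emph{near-geodesic} from $x_0\in X$ to $x_1\in X$ is a continuous map $\varphi$ from $I$ to the space of paths in $\overline X$ from $x_0$ to $x_1$ such that (i) $\varphi(0)$ is a geodesic in $\overline X$ from $x_0$ to $x_1$; (ii) for $0<s\le 1$ the path $\varphi(s)$ lies in $X$; (iii) $\operatorname{length}(\varphi(s))\to\operatorname{length}(\varphi(0))$ as $s\to0$. A \emph{near-geodesic motion planning rule} on $E\subset X\times X$ is a continuous map $\Phi:E\to(\overline X^{\,I})^{I}$ such that, for all $(x_0,x_1)\in E$, $\Phi(x_0,x_1)$ is a near-geodesic from $x_0$ to $x_1$, and $\Phi(x_0,x_1)(0)$ is a geodesic in $X$ if there is a geodesic in $X$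 from $x_0$ to $x_1$. The \emph{geodesic complexity} $\mathrm{GC}(X)$ is the smallest $k$ such that $X\times X$ can be partitioned into locally compact sets $E_0,\dots,E_k$ (possibly empty), each of which has a near-geodesic motion planning rule ($\infty$ if there is no such $k$). For a metric space $Y$, let $F(Y,2)$ be the space of ordered pairs of distinct points of $Y$, with the metric $d((a,a'),(b,b'))=\sqrt{d(a,b)^2+d(a',b')^2}$. \textbf{Theorem.} Let $n$ be even, let $Q$ be a finite subset of $\mathbb R^n$ with at least two points, and let $X=F(\mathbb R^n-Q,2)$ (with $\mathbb R^n$ Euclidean). Then the completion of $X$ is geodesic, and $\mathrm{GC}(X)\le 5$. -/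

import Mathlib

open scoped unitInterval Topology ENNReal
open UniformSpace (Completion)

namespace GeodesicComplexity

/-- The path `γ` is a (minimal, constant speed) geodesic from `x₀` to `x₁` in the metric space `M`. -/
def IsGeodesic {M : Type*} [MetricSpace M] (x₀ x₁ : M) (γ : C(I, M)) : Prop :=
  γ 0 = x₀ ∧ γ 1 = x₁ ∧
    ∃ c : ℝ, ∀ t t' : I, dist (γ t) (γ t') = c * |(t : ℝ) - (t' : ℝ)|

/-- A geodesic space: any two points are joined by a geodesic. -/
def IsGeodesicSpace (M : Type*) [MetricSpace M] : Prop :=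
  ∀ x₀ x₁ : M, ∃ γ : C(I, M), IsGeodesic x₀ x₁ γ

/-- The length of a path: the supremum of the sums of distances between successive points. -/
noncomputable def length {M : Type*} [MetricSpace M] (γ : C(I, M)) : ℝ≥0∞ :=
  eVariationOn γ Set.univ

/-- `φ` is a near-geodesic from `x₀` to `x₁`: a homotopy, with fixed end points, of paths in the
completion of `X`, starting at a geodesic of the completion, lying in `X` at every positive time,
with lengths converging to that of the geodesic as the homotopy parameter tends to `0`. -/
structure IsNearGeodesic {X : Type*} [MetricSpace X] (x₀ x₁ : X)
    (φ : C(I, C(I, Completion X))) : Prop where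
  source : ∀ s, φ s 0 = (x₀ : Completion X)
  target : ∀ s, φ s 1 = (x₁ : Completion X)
  geodesic_zero : IsGeodesic (x₀ : Completion X) (x₁ : Completion X) (φ 0)
  mem_space : ∀ s : I, 0 < s → ∀ t, φ s t ∈ Set.range ((↑) : X → Completion X)
  tendsto_length : Filter.Tendsto (fun s => length (φ s)) (𝓝 0) (𝓝 (length (φ 0)))

/-- `Φ` is a near-geodesic motion planning rule on `E ⊆ X × X`. All mapping spaces carry the
compact-open topology. -/
structure IsNGMPR {X : Type*} [MetricSpace X] (E : Set (X × X))
    (Φ : C(E, C(I, C(I, Completion X)))) : Prop where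
  nearGeodesic : ∀ p : E, IsNearGeodesic p.1.1 p.1.2 (Φ p)
  geodesic_of_exists : ∀ p : E, (∃ γ : C(I, X), IsGeodesic p.1.1 p.1.2 γ) →
    ∃ γ : C(I, X), IsGeodesic p.1.1 p.1.2 γ ∧ ∀ t, Φ p 0 t = (γ t : Completion X)

/-- `X × X` can be partitioned into `k + 1` locally compact sets, each with an NGMPR
(some of the sets may be empty). -/
def HasNGMPRPartition (X : Type*) [MetricSpace X] (k : ℕ) : Prop :=
  ∃ E : Fin (k + 1) → Set (X × X),
    (∀ i j, i ≠ j → Disjoint (E i) (E j)) ∧ (⋃ i, E i) = Set.univ ∧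
    ∀ i, LocallyCompactSpace (E i) ∧ ∃ Φ : C(E i, C(I, C(I, Completion X))), IsNGMPR (E i) Φ

/-- The geodesic complexity of a metric space: the smallest `k` such that `X × X` has a partition
as above into `k + 1` sets, and `⊤` if there is none. -/
noncomputable def GC (X : Type*) [MetricSpace X] : ℕ∞ :=
  sInf {m : ℕ∞ | ∃ k : ℕ, m = k ∧ HasNGMPRPartition X k}

/-- The ordered configuration space `F(Y, 2)` of pairs of distinct points of `Y`, with the metric
induced from the metric `√(d(a, b)² + d(a', b')²)` on `Y × Y`. -/
abbrev ConfigSpace (Y : Type*) [MetricSpace Y] : Type _ :=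
  {p : WithLp 2 (Y × Y) // p.fst ≠ p.snd}

end GeodesicComplexity

namespace GeodesicComplexity

open Filter Set
open scoped RealInnerProductSpace

/-! The completion of `X` is all of `ℝⁿ × ℝⁿ`, where the only geodesic between two points is the
segment. A segment is pushed into `X` by bending it in the direction `K (y - x)`, where `K = J × J`
and `J` is a linear isometry with `J v ⟂ v`, available because `n` is even. Points outside `X` are
those whose first or second coordinate lies in `Q` or whose coordinate difference is `0`. These
three projections intertwine `K` with `J`, so each projected segment is bent orthogonally to itself.
It misses the obstacles on the original segment for every positive bend (`bend_ne_of_mem_segment`)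
and the others for a small one (`bend_ne_of_notMem_segment`).

The size of the bend varies continuously wherever the set of obstacles met is locally constant.
Fixing the number of obstacles, truncated at 2, ensures this (`eventually_hits_eq`): nearby segments
meet no new obstacle, and one that still meets two of the old collinear ones meets them all. The
three truncated counts sum to at most 2 + 2 + 1 = 5, which gives six strata. -/

/-- The segment from `x` to `y`, pushed off in the direction `w` by `r * t * (1 - t)` at time `t`. -/
noncomputable def bend {V : Type*} [NormedAddCommGroup V] [NormedSpace ℝ V]
    (x y w : V) (r t : ℝ) : V :=
  AffineMap.lineMap x y t + (r * (t * (1 - t))) • w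

/-! ### Lengths of bent segments and uniqueness of geodesics -/

section Paths

variable {V : Type*} [NormedAddCommGroup V] [NormedSpace ℝ V]

@[simp] lemma bend_zero_right (x y w : V) (r : ℝ) : bend x y w r 0 = x := by simp [bend]

@[simp] lemma bend_one_right (x y w : V) (r : ℝ) : bend x y w r 1 = y := by simp [bend]

@[simp] lemma bend_zero (x y w : V) (t : ℝ) : bend x y w 0 t = AffineMap.lineMap x y t := by
  simp [bend]

lemma bend_smul (x y w : V) (c r t : ℝ) : bend x y (c • w) r t = bend x y w (r * c) t := by
  simp only [bend, smul_smul]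
  congr 2
  ring

lemma map_bend {W : Type*} [NormedAddCommGroup W] [NormedSpace ℝ W] (L : V →L[ℝ] W)
    (x y w : V) (r t : ℝ) : L (bend x y w r t) = bend (L x) (L y) (L w) r t := by
  simp [bend, AffineMap.lineMap_apply_module]

lemma dist_bend_le (x y w : V) (r : ℝ) {t t' : ℝ} (ht : t ∈ Icc (0 : ℝ) 1)
    (ht' : t' ∈ Icc (0 : ℝ) 1) :
    dist (bend x y w r t) (bend x y w r t') ≤ (dist x y + |r| * ‖w‖) * dist t t' := by
  -- Uses `t(1 - t) - t'(1 - t') = (t - t')(1 - t - t')`.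
  have h1 : bend x y w r t - bend x y w r t'
      = (t - t') • (y - x) + (r * ((t - t') * (1 - t - t'))) • w := by
    simp only [bend, AffineMap.lineMap_apply_module]
    module
  have h2 : |1 - t - t'| ≤ 1 := by
    rw [abs_le]; constructor <;> linarith [ht.1, ht.2, ht'.1, ht'.2]
  rw [dist_eq_norm, h1, Real.dist_eq, dist_comm x y, dist_eq_norm y x]
  refine (norm_add_le _ _).trans ?_
  rw [norm_smul, norm_smul, Real.norm_eq_abs, Real.norm_eq_abs, abs_mul, abs_mul, add_mul]
  have : |r| * (|t - t'| * |1 - t - t'|) * ‖w‖ ≤ |r| * (|t - t'| * 1) * ‖w‖ := by gcongr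
  nlinarith

lemma isGeodesic_comp_lineMap {M : Type*} [MetricSpace M] {f : V → M} (hf : Isometry f)
    (x y : V) (γ : C(I, M)) (hγ : ∀ t, γ t = f (AffineMap.lineMap x y (t : ℝ))) :
    IsGeodesic (f x) (f y) γ := by
  refine ⟨by simp [hγ], by simp [hγ], dist x y, fun t t' => ?_⟩
  rw [hγ, hγ, hf.dist_eq, dist_lineMap_lineMap, Real.dist_eq, mul_comm]

lemma length_bend_le {M : Type*} [MetricSpace M] {f : V → M} (hf : Isometry f)
    (x y w : V) (r : ℝ) (γ : C(I, M)) (hγ : ∀ t : I, γ t = f (bend x y w r t)) :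
    length γ ≤ ENNReal.ofReal (dist x y + |r| * ‖w‖) := by
  have hc : 0 ≤ dist x y + |r| * ‖w‖ := by positivity
  have hlip : LipschitzOnWith (Real.toNNReal (dist x y + |r| * ‖w‖))
      (fun t => f (bend x y w r t)) (Icc (0 : ℝ) 1) := by
    refine LipschitzOnWith.of_dist_le_mul fun t ht t' ht' => ?_
    rw [hf.dist_eq, Real.coe_toNNReal _ hc]
    exact dist_bend_le x y w r ht ht'
  have hval : eVariationOn (Subtype.val : I → ℝ) univ ≤ 1 := by
    have := (Subtype.mono_coe (· ∈ I)).monotoneOn univ |>.eVariationOn_eq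
      (mem_univ (0 : I)) (mem_univ (1 : I))
    have huniv : (univ ∩ Icc (0 : I) 1) = univ := by
      ext t; simp [unitInterval.le_one']
    rw [huniv] at this
    simp [this]
  have heq : (γ : I → M) = (fun t : ℝ => f (bend x y w r t)) ∘ Subtype.val := funext hγ
  rw [length, heq]
  refine (hlip.comp_eVariationOn_le fun t _ => t.2).trans ?_
  calc _ ≤ ((Real.toNNReal (dist x y + |r| * ‖w‖) : NNReal) : ℝ≥0∞) * 1 := by gcongr
    _ = _ := by rw [mul_one]; rfl

lemma edist_le_length {M : Type*} [MetricSpace M] (γ : C(I, M)) :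
    edist (γ 0) (γ 1) ≤ length γ :=
  eVariationOn.edist_le _ (mem_univ _) (mem_univ _)

lemma length_lineMap {M : Type*} [MetricSpace M] {f : V → M} (hf : Isometry f)
    (x y : V) (γ : C(I, M)) (hγ : ∀ t : I, γ t = f (AffineMap.lineMap x y (t : ℝ))) :
    length γ = ENNReal.ofReal (dist x y) := by
  apply le_antisymm
  · simpa using length_bend_le hf x y 0 0 γ (by simpa using hγ)
  · simpa [hγ, hf.edist_eq, edist_dist] using edist_le_length γ

/-- In a strictly convex space the geodesic between two points is unique. -/
lemma IsGeodesic.eq_lineMap [StrictConvexSpace ℝ V] {x y : V} {γ : C(I, V)}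
    (h : IsGeodesic x y γ) (t : I) : γ t = AffineMap.lineMap x y (t : ℝ) := by
  obtain ⟨rfl, rfl, c, hc⟩ := h
  have h01 := hc 0 1
  have h0t := hc 0 t
  have ht1 := hc t 1
  have e : |(t : ℝ) - 1| = 1 - t := by rw [abs_sub_comm, abs_of_nonneg]; linarith [t.2.2]
  simp only [Icc.coe_zero, Icc.coe_one, zero_sub, abs_neg, abs_one, mul_one,
    abs_of_nonneg t.2.1, e] at h01 h0t ht1
  apply eq_lineMap_of_dist_eq_mul_of_dist_eq_mul
  · rw [h0t, h01, mul_comm]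
  · rw [ht1, h01, mul_comm]

end Paths

/-! ### The completion, and planning rules from push-off directions -/

section Completion

variable {X : Type*} [MetricSpace X] {V : Type*} [NormedAddCommGroup V] [NormedSpace ℝ V]

/-- An isometry with dense range into a complete space identifies that space with the completion. -/
lemma exists_isometryEquiv_completion {V : Type*} [MetricSpace V] [CompleteSpace V] {j : X → V} (hj : Isometry j)
    (hd : DenseRange j) : ∃ e : V ≃ᵢ Completion X, ∀ x, e (j x) = (x : Completion X) := by
  have hi : Isometry (Completion.extension j) := hj.completion_extension
  have hx : ∀ x : X, Completion.extension j (x : Completion X) = j x :=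
    Completion.extension_coe hj.uniformContinuous
  have hsurj : Function.Surjective (Completion.extension j) := by
    have hdr : DenseRange (Completion.extension j) :=
      hd.mono (by rintro _ ⟨x, rfl⟩; exact ⟨x, hx x⟩)
    rw [← range_eq_univ, ← hi.isClosedEmbedding.isClosed_range.closure_eq]
    exact hdr.closure_eq
  let e : Completion X ≃ᵢ V := ⟨Equiv.ofBijective _ ⟨hi.injective, hsurj⟩, hi⟩
  exact ⟨e.symm, fun x => by rw [← hx x]; exact e.symm_apply_apply _⟩

lemma isGeodesicSpace_of_isometryEquiv {M : Type*} [MetricSpace M] (e : V ≃ᵢ M) :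
    IsGeodesicSpace M := by
  intro x₀ x₁
  refine ⟨⟨fun t => e (AffineMap.lineMap (e.symm x₀) (e.symm x₁) (t : ℝ)), ?_⟩, ?_⟩
  · exact e.continuous.comp (AffineMap.lineMap_continuous.comp continuous_subtype_val)
  · simpa using isGeodesic_comp_lineMap e.isometry (e.symm x₀) (e.symm x₁)
      ⟨fun t => e (AffineMap.lineMap (e.symm x₀) (e.symm x₁) (t : ℝ)), _⟩ fun t => rfl

/-- A continuous choice of directions in which segments can be pushed into `X` gives a
near-geodesic motion planning rule. -/
theorem exists_isNGMPR [StrictConvexSpace ℝ V] {j : X → V} (hj : Isometry j)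
    (e : V ≃ᵢ Completion X) (he : ∀ x, e (j x) = (x : Completion X)) {E : Set (X × X)}
    (w : E → V) (hw : Continuous w)
    (hmem : ∀ (p : E) (s t : I), 0 < s → bend (j p.1.1) (j p.1.2) (w p) s t ∈ range j) :
    ∃ Φ : C(E, C(I, C(I, Completion X))), IsNGMPR E Φ := by
  obtain ⟨Φ, hΦ⟩ : ∃ Φ : C(E, C(I, C(I, Completion X))), ∀ (p : E) (s t : I),
      Φ p s t = e (bend (j p.1.1) (j p.1.2) (w p) s t) := by
    let F : C((E × I) × I, Completion X) :=
      ⟨fun z => e (bend (j z.1.1.1.1) (j z.1.1.1.2) (w z.1.1) z.1.2 z.2), by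
        have := hj.continuous
        have := e.continuous
        simp only [bend, AffineMap.lineMap_apply_module]
        fun_prop⟩
    exact ⟨F.curry.curry, fun _ _ _ => rfl⟩
  refine ⟨Φ, fun p => ?_, ?_⟩
  · have hF0 : ∀ t, Φ p 0 t = e (AffineMap.lineMap (j p.1.1) (j p.1.2) (t : ℝ)) := by
      intro t; simp [hΦ]
    refine ⟨fun s => by simp [hΦ, he], fun s => by simp [hΦ, he], ?_, ?_, ?_⟩
    · simpa [he] using isGeodesic_comp_lineMap e.isometry _ _ _ hF0
    · intro s hs t
      obtain ⟨x, hx⟩ := hmem p s t hs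
      exact ⟨x, by rw [hΦ, ← hx, he]⟩
    · rw [length_lineMap e.isometry _ _ _ hF0]
      have hlim : Tendsto (fun s : I => ENNReal.ofReal (dist (j p.1.1) (j p.1.2) +
          |(s : ℝ)| * ‖w p‖)) (𝓝 0) (𝓝 (ENNReal.ofReal (dist (j p.1.1) (j p.1.2)))) := by
        have hc : Continuous fun s : I => ENNReal.ofReal (dist (j p.1.1) (j p.1.2) +
          |(s : ℝ)| * ‖w p‖) := ENNReal.continuous_ofReal.comp (by fun_prop)
        simpa using hc.tendsto 0
      -- The length is squeezed between the distance of the end points and the Lipschitz constant of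
      -- the bent path.
      refine tendsto_of_tendsto_of_tendsto_of_le_of_le tendsto_const_nhds hlim
        (fun s => ?_) (fun s => ?_)
      · have := edist_le_length (Φ p s)
        simpa [hΦ, edist_dist, e.dist_eq] using this
      · exact length_bend_le e.isometry _ _ _ _ _ (hΦ p s)
  · rintro p ⟨γ, hγ⟩
    refine ⟨γ, hγ, fun t => ?_⟩
    -- A geodesic of `X` stays a geodesic in `V`, hence is the segment by uniqueness.
    have hg : IsGeodesic (j p.1.1) (j p.1.2) (ContinuousMap.comp ⟨j, hj.continuous⟩ γ) := by
      obtain ⟨h0, h1, c, hc⟩ := hγ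
      exact ⟨by simp [h0], by simp [h1], c, fun t t' => by simpa [hj.dist_eq] using hc t t'⟩
    have := hg.eq_lineMap t
    simp only [ContinuousMap.comp_apply, ContinuousMap.coe_mk] at this
    rw [← he, this]
    simp [hΦ]

end Completion

/-! ### Distance from a point to a segment -/

section Gap

variable {E : Type*} [NormedAddCommGroup E] [NormedSpace ℝ E]

/-- The distance from `q` to the segment from `a` to `b`. -/
noncomputable def gap (q a b : E) : ℝ :=
  sInf ((fun t : I => ‖AffineMap.lineMap a b (t : ℝ) - q‖) '' univ)

lemma continuous_gap (q : E) : Continuous fun z : E × E => gap q z.1 z.2 := by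
  refine IsCompact.continuous_sInf (f := fun (z : E × E) (t : I) =>
    ‖AffineMap.lineMap z.1 z.2 (t : ℝ) - q‖) isCompact_univ ?_
  simp only [AffineMap.lineMap_apply_module]
  fun_prop

lemma gap_nonneg (q a b : E) : 0 ≤ gap q a b := by
  apply Real.sInf_nonneg
  rintro _ ⟨t, -, rfl⟩
  exact norm_nonneg _

lemma gap_le (q a b : E) (t : I) : gap q a b ≤ ‖AffineMap.lineMap a b (t : ℝ) - q‖ := by
  refine csInf_le ⟨0, ?_⟩ ⟨t, mem_univ _, rfl⟩
  rintro _ ⟨t, -, rfl⟩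
  exact norm_nonneg _

lemma mem_segment_iff_lineMap {q a b : E} :
    q ∈ segment ℝ a b ↔ ∃ t : I, AffineMap.lineMap a b (t : ℝ) = q := by
  rw [segment_eq_image_lineMap]
  simp

lemma gap_eq_zero_iff {q a b : E} : gap q a b = 0 ↔ q ∈ segment ℝ a b := by
  rw [mem_segment_iff_lineMap]
  constructor
  · intro h
    have hc : Continuous fun t : I => ‖AffineMap.lineMap a b (t : ℝ) - q‖ := by
      simp only [AffineMap.lineMap_apply_module]; fun_prop
    obtain ⟨t, -, ht⟩ := (isCompact_univ.image hc).sInf_mem (univ_nonempty.image _)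
    refine ⟨t, sub_eq_zero.1 (norm_eq_zero.1 ?_)⟩
    exact ht.trans h
  · rintro ⟨t, rfl⟩
    exact le_antisymm (by simpa using gap_le (AffineMap.lineMap a b (t : ℝ)) a b t)
      (gap_nonneg _ _ _)

lemma isClosed_mem_segment (q : E) : IsClosed {z : E × E | q ∈ segment ℝ z.1 z.2} := by
  simp_rw [← gap_eq_zero_iff]
  exact isClosed_eq (continuous_gap q) continuous_const

end Gap

/-! ### Bent segments avoiding a point -/

section Avoid

variable {E : Type*} [NormedAddCommGroup E] [InnerProductSpace ℝ E]

/-- A bent segment avoids every point of the open segment from which it was pushed off. -/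
lemma bend_ne_of_mem_segment {J : E →L[ℝ] E} (hJ : ∀ v, ⟪J v, v⟫ = 0) (hJn : ∀ v, ‖J v‖ = ‖v‖)
    {q a b : E} (ha : a ≠ q) (hb : b ≠ q) (hq : q ∈ segment ℝ a b) {r t : ℝ} (hr : 0 < r) :
    bend a b (J (b - a)) r t ≠ q := by
  intro h
  obtain ⟨τ, rfl⟩ := mem_segment_iff_lineMap.1 hq
  have hab : b - a ≠ 0 := by
    intro h0
    rw [sub_eq_zero] at h0
    simp [h0] at ha
  have h1 : (t - τ) • (b - a) + (r * (t * (1 - t))) • J (b - a) = 0 := by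
    rw [← sub_eq_zero] at h
    rw [← h]
    simp only [bend, AffineMap.lineMap_apply_module]
    module
  -- Pairing with `J (b - a)` kills the component along the segment, leaving `r t (1 - t) ‖b - a‖² =
  -- 0`; so `t` is an end point.
  have h2 := congrArg (fun v => ⟪J (b - a), v⟫) h1
  simp only [inner_add_right, inner_smul_right, hJ, real_inner_self_eq_norm_sq, hJn,
    inner_zero_right, mul_zero, zero_add] at h2
  have h3 : ‖b - a‖ ≠ 0 := norm_ne_zero_iff.2 hab
  have h4 : t * (1 - t) = 0 := by
    simpa [hr.ne', h3] using h2
  rcases mul_eq_zero.1 h4 with h5 | h5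
  · subst h5
    exact ha (by simpa using h)
  · obtain rfl : t = 1 := by linarith
    exact hb (by simpa using h)

/-- A slightly bent segment avoids the points off the segment. -/
lemma bend_ne_of_notMem_segment {J : E →L[ℝ] E} (hJn : ∀ v, ‖J v‖ = ‖v‖)
    {q a b : E} (hq : q ∉ segment ℝ a b) {r : ℝ} (hr : 0 ≤ r)
    (hrq : r ≤ gap q a b / (1 + ‖b - a‖)) (t : I) :
    bend a b (J (b - a)) r t ≠ q := by
  intro h
  have hg : 0 < gap q a b :=
    (gap_nonneg q a b).lt_of_ne fun h0 => hq (gap_eq_zero_iff.1 h0.symm)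
  have h1 : gap q a b ≤ r * ((t : ℝ) * (1 - t)) * ‖b - a‖ := by
    refine (gap_le q a b t).trans_eq ?_
    rw [← h, bend, sub_add_cancel_left, norm_neg, norm_smul, hJn, Real.norm_of_nonneg]
    exact mul_nonneg hr (mul_nonneg t.2.1 (sub_nonneg.2 t.2.2))
  have h2 : (t : ℝ) * (1 - t) ≤ 1 := by nlinarith [t.2.1, t.2.2, sq_nonneg (t : ℝ)]
  rw [le_div_iff₀ (by positivity)] at hrq
  have h3 : r * ((t : ℝ) * (1 - t)) * ‖b - a‖ ≤ r * ‖b - a‖ := by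
    have : r * ((t : ℝ) * (1 - t)) ≤ r := mul_le_of_le_one_right hr h2
    gcongr
  -- From `r (1 + ‖b - a‖) ≤ gap ≤ r ‖b - a‖`; the summand 1 makes the bound strict.
  have hr0 : r ≤ 0 := by linarith
  have : r = 0 := le_antisymm hr0 hr
  subst this
  simp at h1
  linarith

end Avoid

/-! ### A continuous bend size where the obstacles met are locally constant -/

section Planner

variable {X : Type*} [MetricSpace X]
  {V : Type*} [NormedAddCommGroup V] [NormedSpace ℝ V] [StrictConvexSpace ℝ V]
  {E : Type*} [NormedAddCommGroup E] [InnerProductSpace ℝ E]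

/-- Let `X` be the set of points of `V` whose image under each `L o` differs from `q o`. On a set of
pairs on which it is locally constant which of these obstacles the connecting segment meets, the
segments bent by `δ • K` for a suitable positive function `δ` form a motion planning rule. -/
theorem exists_isNGMPR_of_isOpen {j : X → V} (hj : Isometry j)
    (e : V ≃ᵢ Completion X) (he : ∀ x, e (j x) = (x : Completion X))
    {J : E →L[ℝ] E} (hJ : ∀ v, ⟪J v, v⟫ = 0) (hJn : ∀ v, ‖J v‖ = ‖v‖) {K : V →L[ℝ] V}
    {O : Type*} [Finite O] (L : O → V →L[ℝ] E) (q : O → E) (hL : ∀ o v, L o (K v) = J (L o v))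
    (hrange : ∀ v, v ∈ range j ↔ ∀ o, L o v ≠ q o) {A : Set (X × X)}
    (hA : ∀ o, IsOpen {p : A | q o ∈ segment ℝ (L o (j p.1.1)) (L o (j p.1.2))}) :
    ∃ Φ : C(A, C(I, C(I, Completion X))), IsNGMPR A Φ := by
  classical
  have := Fintype.ofFinite O
  have hjc := hj.continuous
  let g : O → A → ℝ := fun o p => gap (q o) (L o (j p.1.1)) (L o (j p.1.2)) /
    (1 + ‖L o (j p.1.2) - L o (j p.1.1)‖)
  -- An obstacle on the segment imposes no bound, since any positive bend avoids it. The case split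
  -- is continuous because its condition is clopen on `A`.
  let c : O → A → ℝ := fun o p =>
    if q o ∈ segment ℝ (L o (j p.1.1)) (L o (j p.1.2)) then 1 else min 1 (g o p)
  have hpair : ∀ o, Continuous fun p : A => (L o (j p.1.1), L o (j p.1.2)) := fun o => by fun_prop
  have hg : ∀ o, Continuous (g o) := fun o =>
    ((continuous_gap (q o)).comp (hpair o)).div (by fun_prop) fun p => by positivity
  have hc : ∀ o, Continuous (c o) := fun o => by
    refine Continuous.if (fun p hp => ?_) continuous_const (continuous_const.min (hg o))
    have hclopen : IsClopen {p : A | q o ∈ segment ℝ (L o (j p.1.1)) (L o (j p.1.2))} :=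
      ⟨(isClosed_mem_segment (q o)).preimage (hpair o), hA o⟩
    rw [hclopen.frontier_eq] at hp
    exact hp.elim
  have hgpos : ∀ o p, q o ∉ segment ℝ (L o (j p.1.1)) (L o (j p.1.2)) → 0 < g o p := by
    intro o p hq
    exact div_pos ((gap_nonneg _ _ _).lt_of_ne fun h0 => hq (gap_eq_zero_iff.1 h0.symm))
      (by positivity)
  have hcpos : ∀ o p, 0 < c o p := by
    intro o p
    by_cases h : q o ∈ segment ℝ (L o (j p.1.1)) (L o (j p.1.2))
    · simp [c, h]
    · simp [c, h, hgpos o p h]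
  have hcle : ∀ o p, c o p ≤ 1 := by
    intro o p
    by_cases h : q o ∈ segment ℝ (L o (j p.1.1)) (L o (j p.1.2)) <;> simp [c, h]
  -- All factors lie in `(0, 1]`, so the product is positive and below each of them.
  let δ : A → ℝ := fun p => ∏ o, c o p
  have hδ : Continuous δ := continuous_finsetProd _ fun o _ => hc o
  have hδpos : ∀ p, 0 < δ p := fun p => Finset.prod_pos fun o _ => hcpos o p
  have hδle : ∀ o p, δ p ≤ c o p := by
    intro o p
    simp only [δ]
    rw [← Finset.mul_prod_erase _ _ (Finset.mem_univ o)]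
    exact mul_le_of_le_one_right (hcpos o p).le
      (Finset.prod_le_one (fun o _ => (hcpos o p).le) fun o _ => hcle o p)
  refine exists_isNGMPR hj e he (fun p => δ p • K (j p.1.2 - j p.1.1)) (by fun_prop) ?_
  intro p s t hs
  have hs' : (0 : ℝ) < s := hs
  rw [hrange]
  intro o
  have hend : ∀ x, L o (j x) ≠ q o := fun x => (hrange _).1 ⟨x, rfl⟩ o
  rw [bend_smul, map_bend, hL, map_sub]
  by_cases h : q o ∈ segment ℝ (L o (j p.1.1)) (L o (j p.1.2))
  · exact bend_ne_of_mem_segment hJ hJn (hend _) (hend _) h (mul_pos hs' (hδpos p))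
  · refine bend_ne_of_notMem_segment hJn h (mul_pos hs' (hδpos p)).le ?_ t
    have h1 : c o p ≤ g o p := by simp [c, h]
    calc (s : ℝ) * δ p ≤ δ p := mul_le_of_le_one_left (hδpos p).le s.2.2
      _ ≤ g o p := (hδle o p).trans h1

end Planner

/-! ### Counting the obstacles on a segment -/

section Hits

variable {E : Type*} [NormedAddCommGroup E] [InnerProductSpace ℝ E]

/-- The points of `Q` on the segment from `a` to `b`. -/
def hits (Q : Set E) (a b : E) : Set E := {q ∈ Q | q ∈ segment ℝ a b}

/-- The number of points of `Q` on the segment from `a` to `b`, truncated at `2`. -/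
noncomputable def hitLevel (Q : Set E) (a b : E) : ℕ := min 2 (hits Q a b).ncard

lemma hitLevel_le_two (Q : Set E) (a b : E) : hitLevel Q a b ≤ 2 := min_le_left _ _

lemma hits_subset (Q : Set E) (a b : E) : hits Q a b ⊆ Q := sep_subset _ _

lemma hitLevel_mono {Q : Set E} (hQ : Q.Finite) {a b a' b' : E} (h : hits Q a b ⊆ hits Q a' b') :
    hitLevel Q a b ≤ hitLevel Q a' b' :=
  min_le_min_left _ (ncard_le_ncard h (hQ.subset (hits_subset _ _ _)))

/-- Lying off the segment is an open condition on the end points, and `Q` is finite. -/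
lemma eventually_hits_subset {Q : Set E} (hQ : Q.Finite) (a b : E) :
    ∀ᶠ z in 𝓝 (a, b), hits Q z.1 z.2 ⊆ hits Q a b := by
  have h : ∀ q ∈ Q, ∀ᶠ z : E × E in 𝓝 (a, b), q ∈ segment ℝ z.1 z.2 → q ∈ segment ℝ a b := by
    intro q _
    by_cases hq : q ∈ segment ℝ a b
    · exact Eventually.of_forall fun _ _ => hq
    · filter_upwards [(isClosed_mem_segment q).isOpen_compl.mem_nhds (x := (a, b)) hq] with z hz hz'
      exact (hz hz').elim
  filter_upwards [(eventually_all_finite hQ).2 h] with z hz q hq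
  exact ⟨hq.1, hz q hq.1 hq.2⟩

/-- The two vectors are multiples of `b - a` by nonzero scalars of opposite sign. Unlike membership
in the segment, the inequality is open in the end points. -/
lemma inner_neg_of_mem_segment {q a b : E} (ha : a ≠ q) (hb : b ≠ q) (hq : q ∈ segment ℝ a b) :
    ⟪a - q, b - q⟫ < 0 := by
  obtain ⟨t, rfl⟩ := mem_segment_iff_lineMap.1 hq
  have hab : b - a ≠ 0 := by
    intro h0
    rw [sub_eq_zero] at h0
    simp [h0] at ha
  have h1 : a - AffineMap.lineMap a b (t : ℝ) = (-(t : ℝ)) • (b - a) := by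
    simp only [AffineMap.lineMap_apply_module]; module
  have h2 : b - AffineMap.lineMap a b (t : ℝ) = (1 - (t : ℝ)) • (b - a) := by
    simp only [AffineMap.lineMap_apply_module]; module
  have ht0 : (t : ℝ) ≠ 0 := fun h => ha (by simp [h])
  have ht1 : (t : ℝ) ≠ 1 := fun h => hb (by simp [h])
  rw [h1, h2, real_inner_smul_left, real_inner_smul_right, real_inner_self_eq_norm_sq]
  have h3 : 0 < ‖b - a‖ := norm_pos_iff.2 hab
  have h4 : 0 < (t : ℝ) := lt_of_le_of_ne t.2.1 ht0.symm
  have h5 : 0 < 1 - (t : ℝ) := sub_pos.2 (lt_of_le_of_ne t.2.2 ht1)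
  have : 0 < (t : ℝ) * ((1 - t) * ‖b - a‖ ^ 2) := by positivity
  linarith

/-- If a segment contains two distinct points of a line, then it contains all points of the line
which its end points see in opposite directions. -/
lemma mem_segment_of_inner_neg {q q₁ q₂ a₀ b₀ a b : E} (hne : q₁ ≠ q₂)
    (hq₀ : q ∈ segment ℝ a₀ b₀) (h₁₀ : q₁ ∈ segment ℝ a₀ b₀) (h₂₀ : q₂ ∈ segment ℝ a₀ b₀)
    (h₁ : q₁ ∈ segment ℝ a b) (h₂ : q₂ ∈ segment ℝ a b) (hneg : ⟪a - q, b - q⟫ < 0) :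
    q ∈ segment ℝ a b := by
  -- Both segments lie on the line through `q₁` and `q₂`, so everything is measured in multiples of
  -- `v = q₂ - q₁`: `q = a + k v` and `b = a + c v`. The sign condition becomes `k (c - k) > 0`,
  -- which puts `k` strictly between `0` and `c`.
  have key : ∀ {x y : E}, q₁ ∈ segment ℝ x y → q₂ ∈ segment ℝ x y →
      ∃ s₁ c : ℝ, y - x = c • (q₂ - q₁) ∧ q₁ = x + s₁ • (q₂ - q₁) := by
    intro x y h h'
    obtain ⟨t₁, rfl⟩ := mem_segment_iff_lineMap.1 h
    obtain ⟨t₂, rfl⟩ := mem_segment_iff_lineMap.1 h'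
    have ht : (t₂ : ℝ) - t₁ ≠ 0 := by
      intro h0
      rw [sub_eq_zero] at h0
      exact hne (by rw [h0])
    have hd : AffineMap.lineMap x y (t₂ : ℝ) - AffineMap.lineMap x y (t₁ : ℝ)
        = ((t₂ : ℝ) - t₁) • (y - x) := by
      simp only [AffineMap.lineMap_apply_module]; module
    refine ⟨t₁ * ((t₂ : ℝ) - t₁)⁻¹, ((t₂ : ℝ) - t₁)⁻¹, ?_, ?_⟩
    · rw [hd, smul_smul, inv_mul_cancel₀ ht, one_smul]
    · rw [hd, smul_smul, mul_assoc, inv_mul_cancel₀ ht, mul_one, AffineMap.lineMap_apply_module]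
      module
  obtain ⟨s₀, c₀, hc₀, hs₀⟩ := key h₁₀ h₂₀
  obtain ⟨s, c, hc, hs⟩ := key h₁ h₂
  obtain ⟨τ, hτ⟩ := mem_segment_iff_lineMap.1 hq₀
  set v := q₂ - q₁
  have hq : q = a + (s - s₀ + τ * c₀) • v := by
    have h3 : q = a₀ + (τ : ℝ) • (b₀ - a₀) := by
      rw [← hτ, AffineMap.lineMap_apply_module]; module
    have h4 : a₀ = a + s • v - s₀ • v := by
      rw [← hs, eq_sub_iff_add_eq, ← hs₀]
    rw [h3, hc₀, h4]; module
  set k := s - s₀ + τ * c₀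
  have ha : a - q = (-k) • v := by rw [hq]; module
  have hb : b - q = (c - k) • v := by
    have : b = a + c • v := by rw [← hc]; abel
    rw [this, hq]; module
  rw [ha, hb, real_inner_smul_left, real_inner_smul_right, real_inner_self_eq_norm_sq] at hneg
  have hv : 0 < ‖v‖ ^ 2 := by
    have : v ≠ 0 := sub_ne_zero.2 hne.symm
    positivity
  have hk : 0 < k * (c - k) := by
    by_contra h
    push Not at h
    nlinarith
  have hc0 : c ≠ 0 := by
    rintro rfl
    nlinarith [sq_nonneg k]
  refine mem_segment_iff_lineMap.2 ⟨⟨k / c, ?_⟩, ?_⟩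
  · rcases lt_or_gt_of_ne hc0 with hc0 | hc0
    · have hk0 : k < 0 := by
        by_contra h
        push Not at h
        nlinarith
      have : c - k < 0 := by
        by_contra h
        push Not at h
        nlinarith
      exact ⟨div_nonneg_of_nonpos hk0.le hc0.le, (div_le_one_of_neg hc0).2 (by linarith)⟩
    · have hk0 : 0 < k := by
        by_contra h
        push Not at h
        nlinarith
      have : 0 < c - k := by
        by_contra h
        push Not at h
        nlinarith
      exact ⟨by positivity, (div_le_one hc0).2 (by linarith)⟩
  · have : AffineMap.lineMap a b (k / c) = a + (k / c) • (b - a) := by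
      rw [AffineMap.lineMap_apply_module]; module
    rw [this, hc, smul_smul, div_mul_cancel₀ _ hc0, ← hq]

/-- On a set of segments with constant truncated number of points of `Q`, the set of points of `Q`
on the segment is locally constant. -/
lemma eventually_hits_eq {Q : Set E} (hQ : Q.Finite) {a b : E} (ha : a ∉ Q) (hb : b ∉ Q) :
    ∀ᶠ z in 𝓝 (a, b), hitLevel Q z.1 z.2 = hitLevel Q a b → hits Q z.1 z.2 = hits Q a b := by
  have hfin : ∀ x y, (hits Q x y).Finite := fun x y => hQ.subset (hits_subset _ _ _)
  have hneg : ∀ q ∈ hits Q a b, ∀ᶠ z : E × E in 𝓝 (a, b), ⟪z.1 - q, z.2 - q⟫ < 0 := by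
    intro q hq
    have hc : Continuous fun z : E × E => ⟪z.1 - q, z.2 - q⟫ := by fun_prop
    exact hc.tendsto (a, b) |>.eventually_lt_const (inner_neg_of_mem_segment
      (by rintro rfl; exact ha hq.1) (by rintro rfl; exact hb hq.1) hq.2)
  filter_upwards [eventually_hits_subset hQ a b, (eventually_all_finite (hfin a b)).2 hneg]
    with z hz hzneg hlev
  -- Below 2 the truncated count is the true one, and an included set of equal size is equal.
  -- Otherwise two common points determine the line.
  by_cases hcard : (hits Q z.1 z.2).ncard < 2
  · refine eq_of_subset_of_ncard_le hz ?_ (hfin a b)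
    simp only [hitLevel] at hlev
    omega
  · push Not at hcard
    obtain ⟨q₁, q₂, h₁, h₂, hne⟩ := (one_lt_ncard_iff (hfin z.1 z.2)).1 hcard
    refine hz.antisymm fun q hq => ⟨hq.1, ?_⟩
    exact mem_segment_of_inner_neg hne hq.2 (hz h₁).2 (hz h₂).2 h₁.2 h₂.2 (hzneg q hq)

end Hits

/-! ### Stratification by the total number of truncated hits -/

section Partition

variable {X : Type*} [MetricSpace X]
  {V : Type*} [NormedAddCommGroup V] [InnerProductSpace ℝ V] [FiniteDimensional ℝ V]
  {E : Type*} [NormedAddCommGroup E] [InnerProductSpace ℝ E]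

/-- The complement in `V` of finitely many affine subspaces `{v | M i v = q}`, where `q` runs through
a finite set `Q i`, has geodesic complexity at most the maximal total number of truncated hits. -/
theorem hasNGMPRPartition_of_hitLevel_le {j : X → V} (hj : Isometry j) (hd : DenseRange j)
    {J : E →L[ℝ] E} (hJ : ∀ v, ⟪J v, v⟫ = 0) (hJn : ∀ v, ‖J v‖ = ‖v‖) {K : V →L[ℝ] V}
    {ι : Type*} [Fintype ι] (M : ι → V →L[ℝ] E) (Q : ι → Set E) (hQ : ∀ i, (Q i).Finite)
    (hM : ∀ i v, M i (K v) = J (M i v)) (hrange : ∀ v, v ∈ range j ↔ ∀ i, M i v ∉ Q i) {k : ℕ}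
    (hk : ∀ x y : V, ∑ i, hitLevel (Q i) (M i x) (M i y) ≤ k) : HasNGMPRPartition X k := by
  have : CompleteSpace V := FiniteDimensional.complete ℝ V
  have : ProperSpace V := FiniteDimensional.proper ℝ V
  obtain ⟨e, he⟩ := exists_isometryEquiv_completion hj hd
  have hjc := hj.continuous
  have hX : LocallyCompactSpace X := by
    have hopen : IsOpen (range j) := by
      have : range j = ⋂ i, (M i ⁻¹' Q i)ᶜ := by ext v; simp [hrange]
      rw [this]
      exact isOpen_iInter_of_finite fun i =>
        ((hQ i).isClosed.preimage (M i).continuous).isOpen_compl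
    exact (⟨hj.isEmbedding, hopen⟩ : Topology.IsOpenEmbedding j).locallyCompactSpace
  have hend : ∀ x i, M i (j x) ∉ Q i := fun x => (hrange _).1 ⟨x, rfl⟩
  let l : ι → X × X → ℕ := fun i p => hitLevel (Q i) (M i (j p.1)) (M i (j p.2))
  let d : X × X → ℕ := fun p => ∑ i, l i p
  have hpair : ∀ i, Continuous fun p : X × X => (M i (j p.1), M i (j p.2)) := fun i => by fun_prop
  have hl : ∀ p, ∀ᶠ p' in 𝓝 p, ∀ i, l i p' ≤ l i p := by
    intro p
    rw [eventually_all]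
    intro i
    filter_upwards [(hpair i).tendsto p |>.eventually (eventually_hits_subset (hQ i) _ _)] with p' h
    exact hitLevel_mono (hQ i) h
  have hopen : ∀ m, IsOpen {p | d p ≤ m} := by
    intro m
    rw [isOpen_iff_mem_nhds]
    intro p hp
    filter_upwards [hl p] with p' h
    exact (Finset.sum_le_sum fun i _ => h i).trans hp
  have hlc : ∀ m, IsLocallyClosed {p | d p = m} := by
    intro m
    have hclosed : IsClosed {p | m ≤ d p} := by
      rcases m with - | m
      · simp
      · convert (hopen m).isClosed_compl using 1
        ext p
        simp
    refine ⟨_, _, hopen m, hclosed, ?_⟩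
    ext p
    exact le_antisymm_iff
  refine ⟨fun m => {p | d p = m}, ?_, ?_, fun m => ⟨(hlc m).locallyCompactSpace, ?_⟩⟩
  · intro m m' hm
    rw [Set.disjoint_left]
    intro p hp hp'
    exact hm (Fin.ext (hp.symm.trans hp'))
  · rw [eq_univ_iff_forall]
    intro p
    exact mem_iUnion.2 ⟨⟨d p, Nat.lt_succ_of_le (hk _ _)⟩, rfl⟩
  · have := fun i => (hQ i).to_subtype
    refine exists_isNGMPR_of_isOpen hj e he hJ hJn (K := K) (O := Σ i, Q i) (fun o => M o.1)
      (fun o => o.2) (fun o => hM o.1) (fun v => ?_) ?_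
    · simp only [hrange, Sigma.forall, Subtype.forall]
      exact forall_congr' fun i => ⟨fun h q hq h' => h (h' ▸ hq), fun h h' => h _ h' rfl⟩
    · rintro ⟨i, q, hq⟩
      rw [isOpen_iff_mem_nhds]
      intro p hp
      have hp2 : q ∈ segment ℝ (M i (j p.1.1)) (M i (j p.1.2)) := hp
      have h1 := (hpair i).tendsto p.1 |>.eventually
        (eventually_hits_eq (hQ i) (hend p.1.1 i) (hend p.1.2 i))
      have h2 := continuous_subtype_val.tendsto p |>.eventually (h1.and (hl p.1))
      filter_upwards [h2] with p' h
      have hsum : ∑ i, l i p'.1 = ∑ i, l i p.1 := p'.2.trans p.2.symm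
      -- Near `p` no summand exceeds its value at `p`, so equal totals force equal summands.
      have hle := (Finset.sum_eq_sum_iff_of_le fun i _ => h.2 i).1 hsum i (Finset.mem_univ i)
      have : q ∈ hits (Q i) (M i (j p'.1.1)) (M i (j p'.1.2)) := by
        rw [h.1 hle]
        exact ⟨hq, hp2⟩
      exact this.2

lemma GC_le_of_hasNGMPRPartition {k : ℕ} (h : HasNGMPRPartition X k) : GC X ≤ k :=
  sInf_le ⟨k, rfl, h⟩

end Partition

/-! ### The skew isometry and the configuration space -/

section Configurations

/-- Split the space into two halves of equal dimension and take the quarter turn `(x, y) ↦ (-y, x)`.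
-/
lemma exists_skew_isometry {n : ℕ} (hn : Even n) :
    ∃ J : EuclideanSpace ℝ (Fin n) →L[ℝ] EuclideanSpace ℝ (Fin n),
      (∀ v, ⟪J v, v⟫ = 0) ∧ ∀ v, ‖J v‖ = ‖v‖ := by
  obtain ⟨m, rfl⟩ := hn
  let F := EuclideanSpace ℝ (Fin m)
  have hrank : Module.finrank ℝ (WithLp 2 (F × F)) =
      Module.finrank ℝ (EuclideanSpace ℝ (Fin (m + m))) := by
    rw [(WithLp.linearEquiv 2 ℝ (F × F)).finrank_eq]
    simp [F]
  let e : WithLp 2 (F × F) ≃ₗᵢ[ℝ] EuclideanSpace ℝ (Fin (m + m)) :=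
    ((stdOrthonormalBasis ℝ _).reindex (finCongr (by rw [hrank]; simp))).repr
  let R : WithLp 2 (F × F) →ₗ[ℝ] WithLp 2 (F × F) :=
    { toFun := fun v => WithLp.toLp 2 (-v.snd, v.fst)
      map_add' := fun v w => WithLp.ofLp_injective 2 (Prod.ext (neg_add _ _) rfl)
      map_smul' := fun c v => WithLp.ofLp_injective 2 (Prod.ext (smul_neg _ _).symm rfl) }
  have hR : ∀ v, ⟪R v, v⟫ = 0 := by
    intro v
    rw [WithLp.prod_inner_apply]
    simp [R, real_inner_comm]
  have hRn : ∀ v, ‖R v‖ = ‖v‖ := by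
    intro v
    rw [WithLp.prod_norm_eq_of_L2, WithLp.prod_norm_eq_of_L2]
    simp [R, add_comm]
  refine ⟨LinearMap.toContinuousLinearMap (e.toLinearMap ∘ₗ R ∘ₗ e.symm.toLinearMap), ?_, ?_⟩
  · intro v
    obtain ⟨w, rfl⟩ := e.surjective v
    simp [hR]
  · intro v
    simpa [hRn] using e.symm.norm_map v

variable {E : Type*} [NormedAddCommGroup E]

/-- The inclusion of the configuration space of a subset of `E` in `E × E`. -/
def configIncl (S : Set E) (x : ConfigSpace S) : WithLp 2 (E × E) :=
  WithLp.toLp 2 ((x.1.fst : E), (x.1.snd : E))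

lemma isometry_configIncl (S : Set E) : Isometry (configIncl S) := by
  refine Isometry.of_dist_eq fun x y => ?_
  have hp : 0 < (2 : ℝ≥0∞).toReal := by simp
  exact (WithLp.prod_dist_eq_add hp _ _).trans (WithLp.prod_dist_eq_add hp x.1 y.1).symm

lemma mem_range_configIncl {S : Set E} {v : WithLp 2 (E × E)} :
    v ∈ range (configIncl S) ↔ v.fst ∈ S ∧ v.snd ∈ S ∧ v.fst ≠ v.snd := by
  constructor
  · rintro ⟨x, rfl⟩
    exact ⟨x.1.fst.2, x.1.snd.2, fun h => x.2 (Subtype.ext h)⟩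
  · rintro ⟨h1, h2, h3⟩
    exact ⟨⟨WithLp.toLp 2 (⟨v.fst, h1⟩, ⟨v.snd, h2⟩), fun h => h3 (congrArg Subtype.val h)⟩, rfl⟩

/-- Finite sets have dense complement: move the first coordinate off `Q`, then the second off `Q`
and the new first coordinate. -/
lemma denseRange_configIncl [NormedSpace ℝ E] [Nontrivial E] {Q : Set E} (hQ : Q.Finite) :
    DenseRange (configIncl Qᶜ) := by
  have hne : ∀ x : E, (𝓝[≠] x).NeBot := fun x => Module.punctured_nhds_neBot ℝ E x
  have hdense : ∀ {T : Set E}, T.Finite → Dense Tᶜ := fun {T} hT => by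
    simpa [compl_eq_univ_sdiff] using (dense_univ (X := E)).sdiff_finite hT
  have hprod : Dense {z : E × E | z.1 ∉ Q ∧ z.2 ∉ Q ∧ z.1 ≠ z.2} := by
    rw [dense_iff_inter_open]
    rintro U hU ⟨⟨a, b⟩, hab⟩
    obtain ⟨A, B, hA, hB, haA, hbB, hAB⟩ := isOpen_prod_iff.1 hU a b hab
    obtain ⟨a', haA', ha'⟩ := (hdense hQ).inter_open_nonempty A hA ⟨a, haA⟩
    obtain ⟨b', hbB', hb'⟩ := (hdense (hQ.insert a')).inter_open_nonempty B hB ⟨b, hbB⟩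
    refine ⟨(a', b'), hAB ⟨haA', hbB'⟩, ha', fun h => hb' (Or.inr h), fun h => hb' (Or.inl h.symm)⟩
  have himg := ((WithLp.homeomorphProd 2 E E).symm.surjective.denseRange).dense_image
    (WithLp.homeomorphProd 2 E E).symm.continuous hprod
  refine himg.mono ?_
  rintro _ ⟨z, hz, rfl⟩
  exact mem_range_configIncl.2 hz

end Configurations

end GeodesicComplexity

/-! ### The main theorem -/

open GeodesicComplexity in
theorem theorem3p1 (n : ℕ) (hn : Even n) (Q : Set (EuclideanSpace ℝ (Fin n)))
    (hQfin : Q.Finite) (hQ : 2 ≤ Q.ncard) :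
    GeodesicComplexity.IsGeodesicSpace
        (UniformSpace.Completion (GeodesicComplexity.ConfigSpace (Qᶜ : Set _))) ∧
      GeodesicComplexity.GC (GeodesicComplexity.ConfigSpace (Qᶜ : Set _)) ≤ 5 := by
  have : Nontrivial (EuclideanSpace ℝ (Fin n)) := by
    obtain ⟨q₁, q₂, -, -, hne⟩ := (Set.one_lt_ncard_iff hQfin).1 hQ
    exact ⟨q₁, q₂, hne⟩
  have hj := isometry_configIncl (E := EuclideanSpace ℝ (Fin n)) Qᶜ
  have hd := denseRange_configIncl hQfin
  constructor
  · obtain ⟨e, -⟩ := exists_isometryEquiv_completion hj hd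
    exact isGeodesicSpace_of_isometryEquiv e
  · obtain ⟨J, hJ, hJn⟩ := exists_skew_isometry hn
    let E := EuclideanSpace ℝ (Fin n)
    let π₁ : WithLp 2 (E × E) →L[ℝ] E := WithLp.fstL 2 ℝ E E
    let π₂ : WithLp 2 (E × E) →L[ℝ] E := WithLp.sndL 2 ℝ E E
    let K : WithLp 2 (E × E) →L[ℝ] WithLp 2 (E × E) :=
      (WithLp.prodContinuousLinearEquiv 2 ℝ E E).symm.toContinuousLinearMap ∘L
        ((J ∘L π₁).prod (J ∘L π₂))
    have hK₁ : ∀ v, (K v).fst = J v.fst := fun v => rfl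
    have hK₂ : ∀ v, (K v).snd = J v.snd := fun v => rfl
    refine GC_le_of_hasNGMPRPartition (k := 5) <| hasNGMPRPartition_of_hitLevel_le hj hd hJ hJn
      (K := K) ![π₁, π₂, π₁ - π₂] ![Q, Q, {0}] ?_ ?_ ?_ ?_
    · simp [Fin.forall_fin_succ, hQfin]
    · simp [Fin.forall_fin_succ, π₁, π₂, hK₁, hK₂]
    · intro v
      rw [mem_range_configIncl]
      simp [Fin.forall_fin_succ, π₁, π₂, sub_eq_zero]
    · intro x y
      simp only [Fin.sum_univ_three, Matrix.cons_val_zero, Matrix.cons_val_one, Matrix.cons_val]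
      have h1 := hitLevel_le_two Q (π₁ x) (π₁ y)
      have h2 := hitLevel_le_two Q (π₂ x) (π₂ y)
      have h3 : hitLevel {0} ((π₁ - π₂) x) ((π₁ - π₂) y) ≤ 1 := by
        refine (min_le_right _ _).trans ?_
        exact (Set.ncard_le_ncard (hits_subset _ _ _)).trans_eq (Set.ncard_singleton _)
      omega
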